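/- Let $k\ge 1$ and let $n_1,\dots,n_k$ be positive integers with $n:=\sum_i n_i\ge 2$. Let $q_{ij}$ ($1\le i,j\le k$) be nonzero complex numbers, and let $\mathcal B$ be the free unital $\mathbb C$-algebra on $e_1,\dots,e_k$, with the linear operators $\partial_i$ determined by $\partial_i 1=0$ and $\partial_i(e_jx)=\delta_{ij}\,x+q_{ij}\,e_j\,\partial_i x$. A constant is an element without term of degree $0$ that is annihilated by all $\partial_i$. Let $Q=\{1^{n_1},\dots,k^{n_k}\}$ (a multiset), let $\hat Q$ be the set of distinct words $i_1\dots i_n$ obtained by permuting $Q$, and let $\mathcal B_Q\subset\mathcal B$ be the span of the monomials $e_{i_1}\cdots e_{i_n}$, $i_1\dots i_n\in\hat Q$. For each $j$ let $Q_j$ be $Q$ with one $j$ removed, and define $\hat Q_j$ and $\mathcal B_{Q_j}$ in the same way. The orbits in $\hat Q$ and in $\hat Q_j$ are those of the cyclic permutations of the $n$, respectively $n-1$, positions; an orbit is short if it has fewer than $n$, respectively $n-1$, elements. For a word $i_1\dots i_p$ put $a(i_1\dots i_p)=q_{i_pi_1}q_{i_pi_2}\cdots q_{i_pi_{p-1}}$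 and $b_j(i_1\dots i_p)=q_{j i_p}\,a(j\,i_1\dots i_p)$. Let $\chi$ be the number of orbits $O$ in $\hat Q$ with $\prod_{w\in O}a(w)=1$, and let $\chi_j$ be the number of orbits $O$ in $\hat Q_j$ with $\prod_{w\in O}b_j(w)=1$ (the products run over the distinct elements of the orbit). Assume that, for every $j=1,\dots,k$, there are no nonzero constants in $\mathcal B_{Q_j}$. Then the space of constants in $\mathcal B_Q$ is finite-dimensional, of dimension $$\sum_{j=1}^k\chi_j-\chi .$$ If moreover there are no short orbits in $\hat Q$ or in any $\hat Q_j$, and the product of $q_{ij}$ over all ordered pairs of distinct positions of $Q$ is $1$, that is, $\prod_i q_{ii}^{\,n_i(n_i-1)}\prod_{i\ne j}q_{ij}^{\,n_in_j}=1$, then $$\chi=\frac{(n-1)!}{n_1!\cdots n_k!},\qquad \chi_j=\frac{n_j\,(n-2)!}{n_1!\cdots n_k!}\quad(1\le j\le k),$$ and the space of constants in $\mathcal B_Q$ has dimension $\dfrac{(n-2)!}{n_1!\cdots n_k!}$. -/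

import Mathlib

open scoped BigOperators

noncomputable section

namespace QDiff

/-- The free unital `ℂ`-algebra on the generators `e_1, …, e_k`. -/
abbrev FreeAlg (k : ℕ) : Type := FreeAlgebra ℂ (Fin k)

/-- The monomial `e_{i_1} ⋯ e_{i_p}` of a word `i_1 … i_p`. -/
def mono {k : ℕ} (w : List (Fin k)) : FreeAlg k :=
  (w.map (FreeAlgebra.ι ℂ)).prod

/-- The value on a monomial of the `q`-differential operator `∂_i`, by the recursion
`∂_i 1 = 0`, `∂_i (e_j x) = δ_{ij} x + q_{ij} e_j ∂_i x`. -/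
def derivWord {k : ℕ} (q : Fin k → Fin k → ℂ) (i : Fin k) : List (Fin k) → FreeAlg k
  | [] => 0
  | j :: w => (if i = j then mono w else 0) + q i j • (FreeAlgebra.ι ℂ j * derivWord q i w)

/-- The `q`-differential operator `∂_i` on the free algebra: the linear extension of
`derivWord` from the basis of monomials (see `deriv_one` and `deriv_ι_mul`). -/
def deriv {k : ℕ} (q : Fin k → Fin k → ℂ) (i : Fin k) : FreeAlg k →ₗ[ℂ] FreeAlg k :=
  (FreeAlgebra.basisFreeMonoid ℂ (Fin k)).constr ℂ
    (fun w : FreeMonoid (Fin k) => derivWord q i (FreeMonoid.toList w))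

theorem basis_eq_mono {k : ℕ} (w : FreeMonoid (Fin k)) :
    FreeAlgebra.basisFreeMonoid ℂ (Fin k) w = mono (FreeMonoid.toList w) := by
  simp [FreeAlgebra.basisFreeMonoid, mono, FreeAlgebra.equivMonoidAlgebraFreeMonoid,
    FreeMonoid.lift_apply]

theorem deriv_mono {k : ℕ} (q : Fin k → Fin k → ℂ) (i : Fin k) (w : List (Fin k)) :
    deriv q i (mono w) = derivWord q i w := by
  have h := (FreeAlgebra.basisFreeMonoid ℂ (Fin k)).constr_basis ℂ
    (fun w : FreeMonoid (Fin k) => derivWord q i (FreeMonoid.toList w)) (FreeMonoid.ofList w)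
  rw [basis_eq_mono] at h
  simpa [deriv] using h

/-- `∂_i` vanishes on the unit (hence on `ℂ`). -/
theorem deriv_one {k : ℕ} (q : Fin k → Fin k → ℂ) (i : Fin k) : deriv q i 1 = 0 := by
  have h := deriv_mono q i []
  simpa [mono, derivWord] using h

/-- The defining rule `∂_i (e_j x) = δ_{ij} x + q_{ij} e_j ∂_i x`. -/
theorem deriv_ι_mul {k : ℕ} (q : Fin k → Fin k → ℂ) (i j : Fin k) (x : FreeAlg k) :
    deriv q i (FreeAlgebra.ι ℂ j * x) =
      (if i = j then x else 0) + q i j • (FreeAlgebra.ι ℂ j * deriv q i x) := by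
  have key : deriv q i ∘ₗ LinearMap.mulLeft ℂ (FreeAlgebra.ι ℂ j) =
      (if i = j then LinearMap.id else 0) +
        q i j • (LinearMap.mulLeft ℂ (FreeAlgebra.ι ℂ j) ∘ₗ deriv q i) := by
    refine (FreeAlgebra.basisFreeMonoid ℂ (Fin k)).ext fun w => ?_
    rw [basis_eq_mono]
    have h1 : FreeAlgebra.ι ℂ j * mono (FreeMonoid.toList w) =
        mono (j :: FreeMonoid.toList w) := by simp [mono]
    have h2 := deriv_mono q i (FreeMonoid.toList w)
    have h3 := deriv_mono q i (j :: FreeMonoid.toList w)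
    by_cases hij : i = j
    · subst hij
      simp [h1, h2, h3, derivWord]
    · simp [h1, h2, h3, derivWord, hij]
  have := LinearMap.congr_fun key x
  by_cases hij : i = j <;> simpa [hij] using this

/-- For `Q = {1^{n_1}, …, k^{n_k}}`, the set `Q̂` of distinct permutations of `Q`: the words in
which each letter `i` occurs exactly `n_i` times. -/
def words {k : ℕ} (n : Fin k → ℕ) : Set (List (Fin k)) :=
  {w | ∀ i, w.count i = n i}

/-- The multiplicities of `Q_j`, that is, of `Q` with one `j` removed. -/
def remove {k : ℕ} (n : Fin k → ℕ) (j : Fin k) : Fin k → ℕ :=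
  Function.update n j (n j - 1)

/-- The space `B_Q` spanned by the monomials `e_{i_1} ⋯ e_{i_n}` with `i_1 … i_n ∈ Q̂`. -/
def homog {k : ℕ} (n : Fin k → ℕ) : Submodule ℂ (FreeAlg k) :=
  Submodule.span ℂ (mono '' words n)

/-- The sum of the components of positive degree of the free algebra. -/
def positivePart (k : ℕ) : Submodule ℂ (FreeAlg k) :=
  Submodule.span ℂ (mono '' {w : List (Fin k) | w ≠ []})

/-- The space of constants: the elements without term of degree zero that are annihilated by
all the `∂_i`. -/
def constants {k : ℕ} (q : Fin k → Fin k → ℂ) : Submodule ℂ (FreeAlg k) :=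
  positivePart k ⊓ ⨅ i, LinearMap.ker (deriv q i)

/-- The space of constants in `B_Q`. -/
def constantsIn {k : ℕ} (q : Fin k → Fin k → ℂ) (n : Fin k → ℕ) : Submodule ℂ (FreeAlg k) :=
  homog n ⊓ constants q

/-- The commutation factor `a(i_1 … i_p) = q_{i_p i_1} ⋯ q_{i_p i_{p-1}}`. -/
def commFactor {k : ℕ} (q : Fin k → Fin k → ℂ) (w : List (Fin k)) : ℂ :=
  match w.getLast? with
  | none => 1
  | some l => (w.dropLast.map (q l)).prod

/-- The commutation factor `b_j(i_2 … i_p) = q_{j i_p} a(j i_2 … i_p)`. -/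
def commFactorAt {k : ℕ} (q : Fin k → Fin k → ℂ) (j : Fin k) (w : List (Fin k)) : ℂ :=
  match w.getLast? with
  | none => 1
  | some l => q j l * commFactor q (j :: w)

/-- The orbit of a word under the cyclic permutations of its positions, without repetitions. -/
def orbit {k : ℕ} (w : List (Fin k)) : Finset (List (Fin k)) :=
  w.cyclicPermutations.toFinset

/-- The cyclic orbits in `Q̂` on which the cocycle condition `∏ f = 1` holds. -/
def singularOrbits {k : ℕ} (f : List (Fin k) → ℂ) (n : Fin k → ℕ) :
    Set (Finset (List (Fin k))) :=
  {O | ∃ w ∈ words n, O = orbit w ∧ ∏ v ∈ O, f v = 1}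

/-- `χ`: the number of cyclic orbits in `Q̂` on which the cocycle condition holds, for the
commutation factors `a`. -/
def chi {k : ℕ} (q : Fin k → Fin k → ℂ) (n : Fin k → ℕ) : ℕ :=
  (singularOrbits (commFactor q) n).ncard

/-- `χ_j`: the number of cyclic orbits in `Q̂_j` on which the cocycle condition holds, for the
commutation factors `b_j`. -/
def chiAt {k : ℕ} (q : Fin k → Fin k → ℂ) (n : Fin k → ℕ) (j : Fin k) : ℕ :=
  (singularOrbits (commFactorAt q j) (remove n j)).ncard

/-- There are no short orbits in `Q̂`: every cyclic orbit has as many elements as the words have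
letters. -/
def NoShortOrbits {k : ℕ} (n : Fin k → ℕ) : Prop :=
  ∀ w ∈ words n, (orbit w).card = w.length

/-- The product `∏ q_{ij}` over all ordered pairs of elements at distinct positions of `Q`. -/
def pairProduct {k : ℕ} (q : Fin k → Fin k → ℂ) (n : Fin k → ℕ) : ℂ :=
  ∏ i, ∏ j, q i j ^ (if i = j then n i * (n i - 1) else n i * n j)

end QDiff

end

noncomputable section

namespace QDiff

/-! Let N be the length of the words. Since the algebra is free, the constants in B_Q are the kernel
there of the single operator T = ∑_j e_j ∂_j (`constantsIn_eq_map`). On monomials T = t_0 + ⋯ +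
t_{N-1}, where t_p moves the letter at position p to the front, with the factors q for the letters
it crosses. Here t_0 = 1, and C = t_{N-1} is a cyclic rotation weighted by a.

Let D rotate all letters but the first, with weights b_j. Then t_{p+1} C = D t_p
(`moveOp_succ_mul`), and summation gives T(1 - C) = (1 - D)T' with T' = t_0 + ⋯ + t_{N-2}. T' never
touches the last letter l, so on words ending in l it is the operator T of Q_l; the hypothesis on
the B_{Q_j} makes it bijective (`ker_sum_moveOp_eq_bot`).

C and D are weighted permutations, hence semisimple at the eigenvalue 1, and this forces ker T ⊆
range(1 - C) (`finrank_ker_sum_add`). Comparing ranks, dim ker T = dim ker(1 - D) - dim ker(1 - C).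
A fixed vector of a weighted permutation is free on each cycle with weight product 1 and zero on the
others, so these dimensions are ∑ χ_j and χ.

Without short orbits every orbit product equals the product over all pairs of positions; if that is
1, all orbits count, and χ and χ_j are multinomial coefficients divided by the orbit length. -/

/-! ### Weighted permutation operators and their fixed spaces -/

/-- The endomorphism of `X →₀ ℂ` sending the basis vector `x` to `f x` times the basis vector
`g x`. -/
def weightedMap {X Y : Type*} (g : X → Y) (f : X → ℂ) : (X →₀ ℂ) →ₗ[ℂ] (Y →₀ ℂ) :=
  Finsupp.linearCombination ℂ (fun x => Finsupp.single (g x) (f x))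

theorem weightedMap_single {X Y : Type*} (g : X → Y) (f : X → ℂ) (x : X) (c : ℂ) :
    weightedMap g f (Finsupp.single x c) = Finsupp.single (g x) (c * f x) := by
  simp [weightedMap]

theorem weightedMap_apply {X Y : Type*} (g : X ≃ Y) (f : X → ℂ) (v : X →₀ ℂ) (x : X) :
    weightedMap g f v (g x) = f x * v x := by
  induction v using Finsupp.induction_linear with
  | zero => simp
  | add v w hv hw => rw [map_add, Finsupp.add_apply, hv, hw, Finsupp.add_apply, mul_add]
  | single y c =>
    rw [weightedMap_single]
    by_cases h : y = x
    · subst h; simp [mul_comm]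
    · rw [Finsupp.single_eq_of_ne' h, Finsupp.single_eq_of_ne' (g.injective.ne h), mul_zero]

/-- The product of the weights along the first `i` steps of the orbit of `x`. -/
def weightProd {X : Type*} (σ : X → X) (f : X → ℂ) (x : X) (i : ℕ) : ℂ :=
  ∏ l ∈ Finset.range i, f (σ^[l] x)

theorem weightProd_add {X : Type*} (σ : X → X) (f : X → ℂ) (x : X) (i j : ℕ) :
    weightProd σ f x (i + j) = weightProd σ f x i * weightProd σ f (σ^[i] x) j := by
  simp only [weightProd, Finset.prod_range_add, ← Function.iterate_add_apply, add_comm]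

theorem weightedMap_pow_apply {X : Type*} (σ : Equiv.Perm X) (f : X → ℂ) (v : X →₀ ℂ) (x : X)
    (i : ℕ) :
    (weightedMap σ f ^ i) v (σ^[i] x) = weightProd σ f x i * v x := by
  induction i with
  | zero => simp [weightProd]
  | succ i ih =>
    rw [pow_succ', Function.iterate_succ_apply', Module.End.mul_apply, weightedMap_apply, ih,
      weightProd_add]
    simp [weightProd]; ring

/-- A weighted permutation operator acts semisimply at the eigenvalue one. -/
theorem disjoint_ker_range_weightedMap {X : Type*} [Finite X] (σ : Equiv.Perm X) (f : X → ℂ) :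
    Disjoint (LinearMap.ker (1 - weightedMap σ f)) (LinearMap.range (1 - weightedMap σ f)) := by
  rw [Submodule.disjoint_def]
  rintro y hy ⟨z, hz⟩
  set A := weightedMap σ f
  have hAy : A y = y := by
    rw [LinearMap.mem_ker, LinearMap.sub_apply, Module.End.one_apply, sub_eq_zero] at hy
    exact hy.symm
  have hAz : A z = z - y := by
    rw [LinearMap.sub_apply, Module.End.one_apply] at hz
    rw [← hz]; abel
  have hpy : ∀ i, (A ^ i) y = y := fun i => by
    induction i with
    | zero => simp
    | succ i ih => rw [pow_succ, Module.End.mul_apply, hAy, ih]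
  -- A Jordan block at the eigenvalue 1 would make A^i z drift linearly in i.
  have hpz : ∀ i : ℕ, (A ^ i) z = z - (i : ℂ) • y := fun i => by
    induction i with
    | zero => simp
    | succ i ih =>
      rw [pow_succ, Module.End.mul_apply, hAz, map_sub, ih, hpy]
      push_cast
      rw [add_smul, one_smul]; abel
  -- At the order of σ the power of A is diagonal. Where y x ≠ 0 its entry is 1, so it fixes z x,
  -- which rules out the drift.
  have hN : 0 < orderOf σ := orderOf_pos σ
  ext x
  have hx : σ^[orderOf σ] x = x := by
    rw [← Equiv.Perm.coe_pow, pow_orderOf_eq_one]; rfl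
  have h1 := weightedMap_pow_apply σ f y x (orderOf σ)
  have h2 := weightedMap_pow_apply σ f z x (orderOf σ)
  rw [hx] at h1 h2
  change (A ^ _) _ _ = _ at h1 h2
  rw [hpy] at h1
  rw [hpz, Finsupp.sub_apply, Finsupp.smul_apply, smul_eq_mul] at h2
  by_contra hne
  change y x ≠ 0 at hne
  have hw : weightProd σ f x (orderOf σ) = 1 := by
    have : (weightProd σ f x (orderOf σ) - 1) * y x = 0 := by rw [sub_mul, ← h1]; ring
    rcases mul_eq_zero.1 this with h | h
    · exact sub_eq_zero.1 h
    · exact absurd h hne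
  rw [hw, one_mul, sub_eq_self, mul_eq_zero] at h2
  rcases h2 with h | h
  · exact hN.ne' (by exact_mod_cast h)
  · exact hne h

-- The fibres of π are the cycles of σ, and the first `minimalPeriod` iterates of x run through its
-- cycle exactly once.
open scoped Classical in
theorem weightProd_minimalPeriod {X Y : Type*} [Fintype X] (σ : Equiv.Perm X) (f : X → ℂ)
    (π : X → Y) (hπ : ∀ x y, π x = π y ↔ σ.SameCycle x y) (x : X) :
    weightProd σ f x (Function.minimalPeriod σ x) = ∏ z with π z = π x, f z := by
  have himg : (Finset.univ.filter fun z => π z = π x) =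
      (Finset.range (Function.minimalPeriod σ x)).image (fun l => σ^[l] x) := by
    ext z
    simp only [Finset.mem_filter, Finset.mem_univ, true_and, Finset.mem_image, Finset.mem_range]
    constructor
    · intro h
      obtain ⟨i, -, hi⟩ := ((hπ x z).1 h.symm).exists_pow_eq'
      refine ⟨i % Function.minimalPeriod σ x, Nat.mod_lt _ ?_, ?_⟩
      · exact Function.minimalPeriod_pos_of_mem_periodicPts
          (Function.Injective.mem_periodicPts σ.injective x)
      · rw [Function.iterate_mod_minimalPeriod_eq, ← Equiv.Perm.coe_pow, hi]
    · rintro ⟨i, -, rfl⟩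
      refine ((hπ _ _).2 ⟨i, ?_⟩).symm
      rw [zpow_natCast, Equiv.Perm.coe_pow]
  rw [himg, Finset.prod_image, weightProd]
  intro i hi j hj h
  exact Function.iterate_injOn_Iio_minimalPeriod (by simpa using hi) (by simpa using hj) h

theorem mem_ker_one_sub_weightedMap {X : Type*} (σ : Equiv.Perm X) (f : X → ℂ) (v : X →₀ ℂ) :
    v ∈ LinearMap.ker (1 - weightedMap σ f) ↔ ∀ x, v (σ x) = f x * v x := by
  rw [LinearMap.mem_ker, LinearMap.sub_apply, Module.End.one_apply, sub_eq_zero]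
  constructor
  · intro h x
    rw [← weightedMap_apply, ← h]
  · intro h
    ext y
    obtain ⟨x, rfl⟩ := σ.surjective y
    rw [weightedMap_apply, h]

open scoped Classical in
/-- The fixed space of a weighted permutation operator has dimension the number of orbits on
which the product of the weights is one. -/
theorem finrank_ker_one_sub_weightedMap {X Y : Type*} [Fintype X] (σ : Equiv.Perm X) (f : X → ℂ)
    (π : X → Y) (hπ : ∀ x y, π x = π y ↔ σ.SameCycle x y) :
    Module.finrank ℂ (LinearMap.ker (1 - weightedMap σ f)) =
      {y | ∃ x, π x = y ∧ ∏ z with π z = y, f z = 1}.ncard := by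
  set S : Set Y := {y | ∃ x, π x = y ∧ ∏ z with π z = y, f z = 1} with hS
  have hfin : S.Finite := (Set.finite_range π).subset (by rintro y ⟨x, rfl, -⟩; exact ⟨x, rfl⟩)
  have : Fintype S := hfin.fintype
  choose r hr using fun s : S => s.2
  have hiter : ∀ v ∈ LinearMap.ker (1 - weightedMap σ f), ∀ x i,
      v (σ^[i] x) = weightProd σ f x i * v x := by
    intro v hv x i
    have h := weightedMap_pow_apply σ f v x i
    suffices hp : (weightedMap σ f ^ i) v = v by rwa [hp] at h
    rw [LinearMap.mem_ker, LinearMap.sub_apply, Module.End.one_apply, sub_eq_zero] at hv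
    clear h
    induction i with
    | zero => simp
    | succ i ih => rw [pow_succ, Module.End.mul_apply, ← hv, ih]
  have hperiod : ∀ x, σ^[Function.minimalPeriod σ x] x = x := fun x =>
    Function.iterate_minimalPeriod
  have hreach : ∀ x (h : π x ∈ S), ∃ i : ℕ, σ^[i] (r ⟨π x, h⟩) = x := by
    intro x h
    obtain ⟨i, -, hi⟩ := ((hπ _ x).1 (hr ⟨π x, h⟩).1).exists_pow_eq'
    exact ⟨i, by rw [← Equiv.Perm.coe_pow, hi]⟩
  -- A fixed vector is determined by its values at one representative of each cycle in S.
  let E : LinearMap.ker (1 - weightedMap σ f) →ₗ[ℂ] (S → ℂ) :=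
    { toFun := fun v s => v.1 (r s)
      map_add' := fun _ _ => rfl
      map_smul' := fun _ _ => rfl }
  have hEinj : Function.Injective E := by
    rintro ⟨v, hv⟩ ⟨v', hv'⟩ h0
    ext x
    change v x = v' x
    by_cases hx : π x ∈ S
    · obtain ⟨i, hi⟩ := hreach x hx
      have h1 : v (r ⟨π x, hx⟩) = v' (r ⟨π x, hx⟩) := congrFun h0 ⟨π x, hx⟩
      rw [← hi, hiter v hv, hiter v' hv', h1]
    -- One turn around the cycle multiplies the value by the cycle product, which is not 1 here.
    · have hzero : ∀ u ∈ LinearMap.ker (1 - weightedMap σ f), u x = 0 := by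
        intro u hu
        have h1 := hiter u hu x (Function.minimalPeriod σ x)
        rw [hperiod, weightProd_minimalPeriod σ f π hπ] at h1
        by_contra hne
        exact hx ⟨x, rfl, mul_right_cancel₀ hne (by rw [one_mul]; exact h1.symm)⟩
      rw [hzero v hv, hzero v' hv']
  have hEsurj : Function.Surjective E := by
    intro c
    choose! idx hidx using hreach
    -- Transport the prescribed value from the representative along the cycle; `hW` shows that the
    -- number of steps chosen does not matter, since a full turn has weight 1.
    let v : X →₀ ℂ := Finsupp.equivFunOnFinite.symm fun x =>
      if h : π x ∈ S then c ⟨π x, h⟩ * weightProd σ f (r ⟨π x, h⟩) (idx x) else 0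
    have hW : ∀ (s : S) (i j : ℕ), σ^[i] (r s) = σ^[j] (r s) →
        weightProd σ f (r s) i = weightProd σ f (r s) j := by
      intro s i j hij
      have hper : Function.Periodic (weightProd σ f (r s)) (Function.minimalPeriod σ (r s)) := by
        intro i
        have hs := weightProd_minimalPeriod σ f π hπ (r s)
        rw [(hr s).1, (hr s).2] at hs
        rw [add_comm, weightProd_add, hperiod, hs, one_mul]
      rw [← hper.map_mod_nat i, ← hper.map_mod_nat j]
      congr 1
      have hpos : 0 < Function.minimalPeriod σ (r s) :=
        Function.minimalPeriod_pos_of_mem_periodicPts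
          (Function.Injective.mem_periodicPts σ.injective _)
      refine Function.iterate_injOn_Iio_minimalPeriod (f := σ) (x := r s)
        (Nat.mod_lt _ hpos) (Nat.mod_lt _ hpos) ?_
      simpa only [Function.iterate_mod_minimalPeriod_eq] using hij
    have hv : v ∈ LinearMap.ker (1 - weightedMap σ f) := by
      rw [mem_ker_one_sub_weightedMap]
      intro x
      have hπσ : π (σ x) = π x := ((hπ _ _).2 ⟨1, by simp⟩).symm
      by_cases hx : π x ∈ S
      · have hx' : π (σ x) ∈ S := hπσ ▸ hx
        have hs : (⟨π (σ x), hx'⟩ : S) = ⟨π x, hx⟩ := Subtype.ext hπσ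
        have e1 : v (σ x) = c ⟨π (σ x), hx'⟩ * weightProd σ f (r ⟨π (σ x), hx'⟩) (idx (σ x)) := by
          simp [v, hx']
        have e2 : v x = c ⟨π x, hx⟩ * weightProd σ f (r ⟨π x, hx⟩) (idx x) := by
          simp [v, hx]
        have i1 := hidx (σ x) hx'
        have i2 := hidx x hx
        rw [hs] at e1 i1
        rw [e1, e2, hW _ (idx (σ x)) (idx x + 1), weightProd_add, i2]
        · simp [weightProd]; ring
        · rw [i1, Function.iterate_succ_apply', i2]
      · have hx' : π (σ x) ∉ S := hπσ ▸ hx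
        simp [v, hx, hx']
    refine ⟨⟨v, hv⟩, ?_⟩
    funext s
    change v (r s) = c s
    have hs : π (r s) ∈ S := (hr s).1 ▸ s.2
    have hs' : (⟨π (r s), hs⟩ : S) = s := Subtype.ext (hr s).1
    have e1 : v (r s) = c ⟨π (r s), hs⟩ * weightProd σ f (r ⟨π (r s), hs⟩) (idx (r s)) := by
      simp [v, hs]
    have i1 := hidx (r s) hs
    rw [hs'] at e1 i1
    rw [e1, hW s (idx (r s)) 0 (by simpa using i1)]
    simp [weightProd]
  rw [(LinearEquiv.ofBijective E ⟨hEinj, hEsurj⟩).finrank_eq, Module.finrank_fintype_fun_eq_card,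
    Set.ncard_eq_toFinset_card' S, Set.toFinset_card]

/-! ### The abstract kernel formula -/

/-- The kernel dimension of `T = ∑_{p ≤ m} t_p`, where `C = t_m` and `D` satisfy
`t_{p+1} C = D t_p`, so that `T (1 - C) = (1 - D) ∑_{p < m} t_p`. -/
theorem finrank_ker_sum_add {V : Type*} [AddCommGroup V] [Module ℂ V] [FiniteDimensional ℂ V]
    (m : ℕ) (t : ℕ → Module.End ℂ V) (D : Module.End ℂ V) (h0 : t 0 = 1)
    (hD : ∀ p < m, t (p + 1) * t m = D * t p)
    (hinj : LinearMap.ker (∑ p ∈ Finset.range m, t p) = ⊥)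
    (hC : Disjoint (LinearMap.ker (1 - t m)) (LinearMap.range (1 - t m)))
    (hD' : Disjoint (LinearMap.ker (1 - D)) (LinearMap.range (1 - D))) :
    Module.finrank ℂ (LinearMap.ker (∑ p ∈ Finset.range (m + 1), t p)) +
      Module.finrank ℂ (LinearMap.ker (1 - t m)) = Module.finrank ℂ (LinearMap.ker (1 - D)) := by
  set C := t m with hCdef
  set T' := ∑ p ∈ Finset.range m, t p with hT'
  set T := ∑ p ∈ Finset.range (m + 1), t p with hT
  have hTT' : T = T' + C := Finset.sum_range_succ _ _
  have hTC : T * C = C + D * T' := by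
    rw [hT, Finset.sum_range_succ', h0, add_mul, one_mul, Finset.sum_mul, hT', Finset.mul_sum,
      add_comm]
    congr 1
    exact Finset.sum_congr rfl fun p hp => hD p (Finset.mem_range.1 hp)
  have hkey : T * (1 - C) = (1 - D) * T' := by
    rw [mul_sub, mul_one, hTC, hTT', sub_mul, one_mul]; abel
  -- Write x = u + (1 - C)z with Cu = u; the aim is u = 0.
  have hker : LinearMap.ker T ≤ LinearMap.range (1 - C) := by
    have hcompl : LinearMap.ker (1 - C) ⊔ LinearMap.range (1 - C) = ⊤ := by
      apply Submodule.eq_top_of_disjoint _ _ _ hC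
      rw [add_comm, LinearMap.finrank_range_add_finrank_ker]
    intro x hx
    obtain ⟨u, hu, v, ⟨z, hz⟩, huv⟩ := Submodule.mem_sup.1 (hcompl ▸ Submodule.mem_top (x := x))
    suffices u = 0 by rw [← huv, this, zero_add]; exact ⟨z, hz⟩
    have hCu : C u = u := by
      rw [LinearMap.mem_ker, LinearMap.sub_apply, Module.End.one_apply, sub_eq_zero] at hu
      exact hu.symm
    have htu : ∀ p ≤ m, t p u = (D ^ p) u := by
      intro p
      induction p with
      | zero => intro _; simp [h0]
      | succ p ih =>
        intro hp
        have := LinearMap.congr_fun (hD p hp) u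
        rw [Module.End.mul_apply, hCu, Module.End.mul_apply, ih (by omega)] at this
        rw [this, pow_succ', Module.End.mul_apply]
    have hT'u : T' u ∈ LinearMap.ker (1 - D) := by
      have := LinearMap.congr_fun hkey u
      rw [Module.End.mul_apply, Module.End.mul_apply, LinearMap.mem_ker.1 hu, map_zero] at this
      exact LinearMap.mem_ker.2 this.symm
    -- Each t_p u - u = (D^p - 1)u is divisible by 1 - D.
    have hsum : T' u - (m : ℂ) • u ∈ LinearMap.range (1 - D) := by
      have : T' u - (m : ℂ) • u = ∑ p ∈ Finset.range m, (t p u - u) := by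
        rw [Finset.sum_sub_distrib, hT', LinearMap.sum_apply]
        simp [Nat.cast_smul_eq_nsmul]
      rw [this]
      refine Submodule.sum_mem _ fun p hp => ?_
      rw [htu p (Finset.mem_range.1 hp).le]
      have hgeom := mul_neg_geom_sum D p
      refine ⟨-(∑ i ∈ Finset.range p, D ^ i) u, ?_⟩
      rw [map_neg, ← Module.End.mul_apply, hgeom]
      simp
    have hTu : T' u + u ∈ LinearMap.range (1 - D) := by
      refine ⟨-(T' z), ?_⟩
      have h1 := LinearMap.congr_fun hkey z
      rw [Module.End.mul_apply, Module.End.mul_apply, hz] at h1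
      rw [LinearMap.mem_ker, ← huv, map_add] at hx
      rw [map_neg, ← h1, ← eq_neg_of_add_eq_zero_left hx, hTT', LinearMap.add_apply, hCu]
    -- Eliminating u from the two relations puts (m + 1)T'u in range(1 - D), while T'u lies in ker(1
    -- - D).
    have hzero : T' u = 0 := by
      have h1 : ((m : ℂ) + 1) • T' u ∈ LinearMap.range (1 - D) := by
        have := Submodule.add_mem _ (Submodule.smul_mem _ (m : ℂ) hTu) hsum
        convert this using 1
        rw [smul_add, add_smul, one_smul]; abel
      have h2 := (Submodule.disjoint_def.1 hD') _ (Submodule.smul_mem _ ((m : ℂ) + 1) hT'u) h1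
      exact (smul_eq_zero.1 h2).resolve_left (by exact_mod_cast Nat.succ_ne_zero m)
    exact (LinearMap.ker_eq_bot'.1 hinj) u hzero
  have hbij : Function.Surjective T' :=
    LinearMap.injective_iff_surjective.1 (LinearMap.ker_eq_bot.1 hinj)
  have hrk : Module.finrank ℂ (LinearMap.range (T * (1 - C))) =
      Module.finrank ℂ (LinearMap.range (1 - D)) := by
    rw [hkey, Module.End.mul_eq_comp,
      LinearMap.range_comp_of_range_eq_top _ (LinearMap.range_eq_top.2 hbij)]
  have hrk2 : Module.finrank ℂ (LinearMap.range (T * (1 - C))) +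
      Module.finrank ℂ (LinearMap.ker T) = Module.finrank ℂ (LinearMap.range (1 - C)) := by
    have h := LinearMap.finrank_range_add_finrank_ker (T.domRestrict (LinearMap.range (1 - C)))
    rw [LinearMap.range_domRestrict, ← LinearMap.range_comp] at h
    rw [Module.End.mul_eq_comp, ← h, LinearMap.ker_domRestrict]
    congr 1
    exact ((Submodule.comapSubtypeEquivOfLe hker).finrank_eq).symm
  have e1 := LinearMap.finrank_range_add_finrank_ker (1 - C)
  have e2 := LinearMap.finrank_range_add_finrank_ker (1 - D)
  omega

/-! ### Words with given multiplicities -/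

variable {k : ℕ} {n : Fin k → ℕ}

theorem words_of_perm {v w : List (Fin k)} (h : v.Perm w) (hw : w ∈ words n) : v ∈ words n :=
  fun i => (h.count_eq i).trans (hw i)

theorem length_of_mem_words {w : List (Fin k)} (hw : w ∈ words n) : w.length = ∑ i, n i := by
  rw [← Finset.sum_congr rfl fun i _ => hw i]
  clear hw
  induction w with
  | nil => simp
  | cons j w ih => simp [List.count_cons, Finset.sum_add_distrib, ih]

instance : Finite (words n) :=
  (List.finite_length_eq (Fin k) (∑ i, n i)).subset fun _ hw => length_of_mem_words hw

instance : Fintype (words n) := Fintype.ofFinite _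

theorem cons_mem_words {j : Fin k} {w : List (Fin k)} (hj : 0 < n j) :
    j :: w ∈ words n ↔ w ∈ words (remove n j) := by
  simp only [words, Set.mem_ofPred_eq, remove]
  refine forall_congr' fun i => ?_
  by_cases h : i = j
  · subst h; simp; omega
  · simp [Function.update_of_ne h, Ne.symm h]

theorem pos_of_mem_words {j : Fin k} {w : List (Fin k)} (hw : w ∈ words n) (hj : j ∈ w) :
    0 < n j := by
  rw [← hw j]; exact List.count_pos_iff.2 hj

theorem sum_remove {j : Fin k} (hj : 0 < n j) : ∑ i, remove n j i = (∑ i, n i) - 1 := by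
  rw [remove, Finset.sum_update_of_mem (Finset.mem_univ j),
    ← Finset.add_sum_erase _ n (Finset.mem_univ j), Finset.sdiff_singleton_eq_erase]
  omega

theorem exists_split {α : Type*} (w : List α) (p : ℕ) (hp : p < w.length) :
    ∃ a m b, w = a ++ m :: b ∧ a.length = p :=
  ⟨w.take p, w[p], w.drop (p + 1), by simp, by simp [hp.le]⟩

theorem exists_snoc {w : List (Fin k)} (h : 0 < w.length) : ∃ v l, w = v ++ [l] :=
  ⟨w.dropLast, w.getLast (List.ne_nil_of_length_pos h), (List.dropLast_concat_getLast _).symm⟩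

/-! ### Letter moves and rotations of words -/

/-- Move the letter at position `p` to the front. -/
def moveFront (p : ℕ) (w : List (Fin k)) : List (Fin k) :=
  match w[p]? with
  | some m => m :: w.eraseIdx p
  | none => w

/-- The commutation factor picked up when the letter at position `p` moves to the front. -/
def moveWeight (q : Fin k → Fin k → ℂ) (p : ℕ) (w : List (Fin k)) : ℂ :=
  match w[p]? with
  | some m => ((w.take p).map (q m)).prod
  | none => 0

theorem moveFront_split (a b : List (Fin k)) (m : Fin k) :
    moveFront a.length (a ++ m :: b) = m :: (a ++ b) := by
  simp [moveFront, List.eraseIdx_append_of_length_le]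

theorem moveWeight_split (q : Fin k → Fin k → ℂ) (a b : List (Fin k)) (m : Fin k) :
    moveWeight q a.length (a ++ m :: b) = (a.map (q m)).prod := by
  simp [moveWeight]

theorem moveFront_perm (p : ℕ) (w : List (Fin k)) : (moveFront p w).Perm w := by
  by_cases hp : p < w.length
  · obtain ⟨a, m, b, rfl, rfl⟩ := exists_split w p hp
    rw [moveFront_split]
    exact List.perm_middle.symm
  · rw [moveFront, List.getElem?_eq_none (not_lt.1 hp)]

theorem commFactor_snoc (q : Fin k → Fin k → ℂ) (v : List (Fin k)) (l : Fin k) :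
    commFactor q (v ++ [l]) = (v.map (q l)).prod := by
  simp [commFactor]

theorem commFactorAt_snoc (q : Fin k → Fin k → ℂ) (j : Fin k) (v : List (Fin k)) (l : Fin k) :
    commFactorAt q j (v ++ [l]) = q j l * (q l j * (v.map (q l)).prod) := by
  rw [commFactorAt, ← List.cons_append, commFactor_snoc]
  simp

theorem rotate_snoc (v : List (Fin k)) (l : Fin k) :
    (v ++ [l]).rotate ((v ++ [l]).length - 1) = l :: v := by
  simp [List.rotate_append_length_eq]

/-- The cyclic permutation of words moving the first letter to the end. -/
def rotPerm (n : Fin k → ℕ) : Equiv.Perm (words n) where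
  toFun w := ⟨w.1.rotate 1, words_of_perm (List.rotate_perm _ _) w.2⟩
  invFun w := ⟨w.1.rotate (w.1.length - 1), words_of_perm (List.rotate_perm _ _) w.2⟩
  left_inv w := by
    rcases w with ⟨_ | ⟨j, v⟩, h⟩
    · simp
    · ext1
      simp only [List.length_rotate, List.rotate_rotate]
      rw [show 1 + ((j :: v).length - 1) = (j :: v).length by simp [add_comm], List.rotate_length]
  right_inv w := by
    rcases w with ⟨_ | ⟨j, v⟩, h⟩
    · simp
    · ext1
      simp only [List.rotate_rotate]
      rw [show ((j :: v).length - 1) + 1 = (j :: v).length by simp, List.rotate_length]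

theorem rotPerm_pow (i : ℕ) (w : words n) : ((rotPerm n ^ i) w).1 = w.1.rotate i := by
  induction i with
  | zero => simp
  | succ i ih =>
    rw [pow_succ', Equiv.Perm.mul_apply, ← List.rotate_rotate, ← ih]; rfl

theorem sameCycle_rotPerm (v w : words n) :
    (rotPerm n).SameCycle v w ↔ v.1.IsRotated w.1 := by
  constructor
  · intro h
    obtain ⟨i, -, hi⟩ := h.exists_pow_eq'
    exact ⟨i, by rw [← rotPerm_pow, hi]⟩
  · rintro ⟨i, hi⟩
    exact ⟨i, by rw [zpow_natCast]; exact Subtype.ext (by rw [rotPerm_pow, hi])⟩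

/-- Apply a map of words to the tail, keeping the first letter. -/
def onTail (g : List (Fin k) → List (Fin k)) : List (Fin k) → List (Fin k)
  | [] => []
  | j :: v => j :: g v

theorem onTail_perm {g : List (Fin k) → List (Fin k)} (hg : ∀ v, (g v).Perm v) :
    ∀ w, (onTail g w).Perm w
  | [] => List.Perm.refl _
  | j :: v => (hg v).cons j

/-- The cyclic permutation of all the positions but the first. -/
def tailRotPerm (n : Fin k → ℕ) : Equiv.Perm (words n) where
  toFun w := ⟨onTail (fun v => v.rotate 1) w.1,
    words_of_perm (onTail_perm (fun _ => List.rotate_perm _ _) _) w.2⟩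
  invFun w := ⟨onTail (fun v => v.rotate (v.length - 1)) w.1,
    words_of_perm (onTail_perm (fun _ => List.rotate_perm _ _) _) w.2⟩
  left_inv w := by
    rcases w with ⟨_ | ⟨i, _ | ⟨j, v⟩⟩, h⟩
    · simp [onTail]
    · simp [onTail]
    · ext1
      simp only [onTail, List.length_rotate, List.rotate_rotate]
      rw [show 1 + ((j :: v).length - 1) = (j :: v).length by simp [add_comm], List.rotate_length]
  right_inv w := by
    rcases w with ⟨_ | ⟨i, _ | ⟨j, v⟩⟩, h⟩
    · simp [onTail]
    · simp [onTail]
    · ext1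
      simp only [onTail, List.rotate_rotate]
      rw [show ((j :: v).length - 1) + 1 = (j :: v).length by simp, List.rotate_length]

theorem tailRotPerm_pow (i : ℕ) (w : words n) :
    ((tailRotPerm n ^ i) w).1 = onTail (fun v => v.rotate i) w.1 := by
  induction i with
  | zero => rcases w with ⟨_ | ⟨j, v⟩, h⟩ <;> simp [onTail]
  | succ i ih =>
    rw [pow_succ', Equiv.Perm.mul_apply]
    change onTail (fun v => v.rotate 1) ((tailRotPerm n ^ i) w).1 = _
    rw [ih]
    rcases w with ⟨_ | ⟨j, v⟩, h⟩ <;> simp [onTail, List.rotate_rotate]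

theorem sameCycle_tailRotPerm (v w : words n) :
    (tailRotPerm n).SameCycle v w ↔ v.1.head? = w.1.head? ∧ v.1.tail.IsRotated w.1.tail := by
  constructor
  · intro h
    obtain ⟨i, -, hi⟩ := h.exists_pow_eq'
    rw [← hi, tailRotPerm_pow]
    rcases v with ⟨_ | ⟨j, v⟩, h⟩
    · simp [onTail]
    · exact ⟨rfl, i, rfl⟩
  · rintro ⟨h, i, hi⟩
    refine ⟨i, ?_⟩
    rw [zpow_natCast]
    refine Subtype.ext ?_
    rw [tailRotPerm_pow]
    rcases v with ⟨_ | ⟨j, v⟩, hv⟩ <;> rcases w with ⟨_ | ⟨j', w⟩, hw⟩ <;> simp_all [onTail]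

/-! ### The operators t_p and D on coordinate vectors -/

/-- The operator moving the letter at position `p` to the front. -/
def moveOp (q : Fin k → Fin k → ℂ) (n : Fin k → ℕ) (p : ℕ) : Module.End ℂ (words n →₀ ℂ) :=
  weightedMap (fun w => ⟨moveFront p w.1, words_of_perm (moveFront_perm p w.1) w.2⟩)
    (fun w => moveWeight q p w.1)

/-- The weight `b_j(v)` of the word `j v`. -/
def tailWeight (q : Fin k → Fin k → ℂ) : List (Fin k) → ℂ
  | [] => 1
  | j :: v => commFactorAt q j v

/-- The operator rotating all letters but the first, weighted by the factors `b_j`. -/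
def tailOp (q : Fin k → Fin k → ℂ) (n : Fin k → ℕ) : Module.End ℂ (words n →₀ ℂ) :=
  weightedMap ((tailRotPerm n)⁻¹ : Equiv.Perm (words n)) (fun w => tailWeight q w.1)

theorem weightedMap_congr {X Y : Type*} {g g' : X → Y} {f f' : X → ℂ} (hg : ∀ x, g x = g' x)
    (hf : ∀ x, f x = f' x) : weightedMap g f = weightedMap g' f' := by
  rw [funext hg, funext hf]

theorem moveOp_zero (q : Fin k → Fin k → ℂ) (hn : 0 < ∑ i, n i) : moveOp q n 0 = 1 := by
  refine Finsupp.lhom_ext fun w c => ?_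
  rw [moveOp, weightedMap_single, Module.End.one_apply]
  obtain ⟨_ | ⟨j, v⟩, hw⟩ := w
  -- The empty word must be excluded: there `moveWeight` takes its default value 0.
  · have := length_of_mem_words hw
    simp at this; omega
  · simp [moveFront, moveWeight]

theorem moveOp_last (q : Fin k → Fin k → ℂ) (hn : 0 < ∑ i, n i) :
    moveOp q n (∑ i, n i - 1) =
      weightedMap ((rotPerm n)⁻¹ : Equiv.Perm (words n)) (fun w => commFactor q w.1) := by
  refine weightedMap_congr (fun w => Subtype.ext ?_) (fun w => ?_)
  · change moveFront _ w.1 = w.1.rotate (w.1.length - 1)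
    rw [← length_of_mem_words w.2]
    obtain ⟨v, l, hv⟩ := exists_snoc (by rw [length_of_mem_words w.2]; exact hn)
    rw [hv, rotate_snoc, List.length_append, List.length_singleton, Nat.add_sub_cancel,
      moveFront_split, List.append_nil]
  · rw [← length_of_mem_words w.2]
    obtain ⟨v, l, hv⟩ := exists_snoc (by rw [length_of_mem_words w.2]; exact hn)
    rw [hv, List.length_append, List.length_singleton, Nat.add_sub_cancel,
      moveWeight_split, commFactor_snoc]

/-- Both sides send a m b l to m l a b. On the left, l crosses a, m, b and then m crosses l and a;
on the right, m crosses only a, and the missing factor q_{ml} is the extra factor in b_m. -/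
theorem moveOp_succ_mul (q : Fin k → Fin k → ℂ) (hn : 0 < ∑ i, n i) (p : ℕ)
    (hp : p < ∑ i, n i - 1) :
    moveOp q n (p + 1) * moveOp q n (∑ i, n i - 1) = tailOp q n * moveOp q n p := by
  rw [moveOp_last q hn]
  refine Finsupp.lhom_ext fun w c => ?_
  rw [Module.End.mul_apply, Module.End.mul_apply, moveOp, moveOp, tailOp, weightedMap_single,
    weightedMap_single, weightedMap_single, weightedMap_single]
  obtain ⟨w, hw⟩ := w
  have hlen := length_of_mem_words hw
  obtain ⟨v, l, rfl⟩ := exists_snoc (hlen.symm ▸ hn)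
  obtain ⟨a, m, b, rfl, rfl⟩ := exists_split v p (by simp at hlen; omega)
  have e1 : (((rotPerm n)⁻¹ : Equiv.Perm (words n)) ⟨a ++ m :: b ++ [l], hw⟩).1 =
      (l :: a) ++ m :: b := rotate_snoc _ _
  have e2 : moveFront a.length (a ++ m :: b ++ [l]) = m :: (a ++ b ++ [l]) := by
    rw [List.append_assoc, List.cons_append, moveFront_split, List.append_assoc]
  have e3 : moveWeight q a.length (a ++ m :: b ++ [l]) = (a.map (q m)).prod := by
    rw [List.append_assoc, List.cons_append, moveWeight_split]
  congr 1
  · refine Subtype.ext ?_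
    change moveFront _ _ = onTail (fun v => v.rotate (v.length - 1)) (moveFront _ _)
    rw [e1, e2, onTail, rotate_snoc, show a.length + 1 = (l :: a).length from rfl,
      moveFront_split]
    rfl
  · simp only [e1, e2, e3, tailWeight, commFactorAt_snoc, commFactor_snoc]
    rw [show a.length + 1 = (l :: a).length from rfl, moveWeight_split]
    simp only [List.map_cons, List.map_append, List.prod_cons, List.prod_append]
    ring

/-! ### Constants as the kernel of ∑_j e_j ∂_j -/

theorem derivWord_eq_sum (q : Fin k → Fin k → ℂ) (j : Fin k) (w : List (Fin k)) :
    derivWord q j w = ∑ p ∈ Finset.range w.length,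
      if w[p]? = some j then ((w.take p).map (q j)).prod • mono (w.eraseIdx p) else 0 := by
  induction w with
  | nil => simp [derivWord]
  | cons c w ih =>
    rw [derivWord, ih, List.length_cons, Finset.sum_range_succ', add_comm, Finset.mul_sum,
      Finset.smul_sum]
    congr 1
    · refine Finset.sum_congr rfl fun p _ => ?_
      by_cases h : w[p]? = some j
      · simp [h, mono, mul_smul]
      · simp [h]
    · simp [eq_comm]

/-- The derivative ∂_j deletes an occurrence of j and e_j puts it back in front; at each position
only the letter standing there contributes. -/
theorem sum_ι_mul_deriv_mono (q : Fin k → Fin k → ℂ) (w : List (Fin k)) :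
    ∑ j, FreeAlgebra.ι ℂ j * deriv q j (mono w) =
      ∑ p ∈ Finset.range w.length, moveWeight q p w • mono (moveFront p w) := by
  simp only [deriv_mono, derivWord_eq_sum, Finset.mul_sum]
  rw [Finset.sum_comm]
  refine Finset.sum_congr rfl fun p hp => ?_
  rw [Finset.sum_eq_single (w[p]'(Finset.mem_range.1 hp))]
  · simp [moveWeight, moveFront, mono, List.getElem?_eq_getElem (Finset.mem_range.1 hp)]
  · intro j _ hj
    rw [if_neg, mul_zero]
    rw [List.getElem?_eq_getElem (Finset.mem_range.1 hp), Option.some_inj]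
    exact hj.symm
  · simp

/-- Coordinate vectors as elements of the free algebra. -/
def toFreeAlg (n : Fin k → ℕ) : (words n →₀ ℂ) →ₗ[ℂ] FreeAlg k :=
  Finsupp.linearCombination ℂ (fun w : words n => mono w.1)

theorem toFreeAlg_single (w : words n) (c : ℂ) :
    toFreeAlg n (Finsupp.single w c) = c • mono w.1 := by
  simp [toFreeAlg]

theorem toFreeAlg_injective : Function.Injective (toFreeAlg n) := by
  have h := (FreeAlgebra.basisFreeMonoid ℂ (Fin k)).linearIndependent.comp
    (fun w : words n => FreeMonoid.ofList w.1) (fun v w h => Subtype.ext h)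
  have h2 : (FreeAlgebra.basisFreeMonoid ℂ (Fin k)) ∘
      (fun w : words n => FreeMonoid.ofList w.1) = fun w : words n => mono w.1 :=
    funext fun w => basis_eq_mono _
  rw [h2] at h
  exact h

theorem range_toFreeAlg : LinearMap.range (toFreeAlg n) = homog n := by
  rw [toFreeAlg, Finsupp.range_linearCombination, homog, Set.image_eq_range]

/-- The total operator `∑_j e_j ∂_j` in coordinates. -/
def eulerOp (q : Fin k → Fin k → ℂ) (n : Fin k → ℕ) : Module.End ℂ (words n →₀ ℂ) :=
  ∑ p ∈ Finset.range (∑ i, n i), moveOp q n p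

theorem sum_ι_mul_deriv_toFreeAlg (q : Fin k → Fin k → ℂ) (v : words n →₀ ℂ) :
    ∑ j, FreeAlgebra.ι ℂ j * deriv q j (toFreeAlg n v) = toFreeAlg n (eulerOp q n v) := by
  induction v using Finsupp.induction_linear with
  | zero => simp
  | add v w hv hw => simp only [map_add, mul_add, Finset.sum_add_distrib, hv, hw]
  | single w c =>
    simp only [toFreeAlg_single, map_smul, mul_smul_comm, ← Finset.smul_sum,
      sum_ι_mul_deriv_mono, eulerOp, LinearMap.sum_apply, moveOp, weightedMap_single, map_sum,
      length_of_mem_words w.2]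
    simp only [Finset.smul_sum, mul_smul]

/-- With all q equal to 0, the operator ∂_i just strips a leading e_i, so it extracts the component
z i. -/
theorem eq_zero_of_sum_ι_mul_eq_zero (z : Fin k → FreeAlg k)
    (h : ∑ j, FreeAlgebra.ι ℂ j * z j = 0) (i : Fin k) : z i = 0 := by
  have h2 := congrArg (deriv (fun _ _ => 0) i) h
  simpa [map_sum, deriv_ι_mul] using h2

theorem homog_le_positivePart (hn : 0 < ∑ i, n i) : homog n ≤ positivePart k := by
  refine Submodule.span_mono (Set.image_mono fun w hw h => ?_)
  have := length_of_mem_words hw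
  rw [h, List.length_nil] at this
  omega

theorem constantsIn_eq_map (q : Fin k → Fin k → ℂ) (hn : 0 < ∑ i, n i) :
    constantsIn q n = (LinearMap.ker (eulerOp q n)).map (toFreeAlg n) := by
  ext x
  constructor
  · rintro ⟨hx, -, hx'⟩
    rw [← range_toFreeAlg] at hx
    obtain ⟨v, rfl⟩ := hx
    refine ⟨v, ?_, rfl⟩
    rw [SetLike.mem_coe, LinearMap.mem_ker]
    apply toFreeAlg_injective
    rw [← sum_ι_mul_deriv_toFreeAlg, map_zero]
    refine Finset.sum_eq_zero fun j _ => ?_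
    rw [LinearMap.mem_ker.1 ((Submodule.mem_iInf _).1 hx' j), mul_zero]
  · rintro ⟨v, hv, rfl⟩
    have hmem : toFreeAlg n v ∈ homog n := range_toFreeAlg (n := n) ▸ ⟨v, rfl⟩
    refine ⟨hmem, homog_le_positivePart hn hmem, (Submodule.mem_iInf _).2 fun j => ?_⟩
    refine eq_zero_of_sum_ι_mul_eq_zero (fun j => deriv q j (toFreeAlg n v)) ?_ j
    rw [sum_ι_mul_deriv_toFreeAlg, LinearMap.mem_ker.1 hv, map_zero]

/-! ### Bijectivity of the partial sum T' -/

theorem snoc_mem_words {l : Fin k} {v : List (Fin k)} (hl : 0 < n l) :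
    v ++ [l] ∈ words n ↔ v ∈ words (remove n l) := by
  rw [← cons_mem_words hl]
  exact ⟨words_of_perm (List.perm_append_singleton l v).symm,
    words_of_perm (List.perm_append_singleton l v)⟩

/-- Right multiplication by the letter `l`. -/
def snocMap (n : Fin k → ℕ) (l : Fin k) (hl : 0 < n l) :
    (words (remove n l) →₀ ℂ) →ₗ[ℂ] (words n →₀ ℂ) :=
  weightedMap (fun v => ⟨v.1 ++ [l], (snoc_mem_words hl).2 v.2⟩) (fun _ => 1)

/-- A move from a position before the last letter neither displaces nor crosses that letter. -/
theorem moveOp_snocMap (q : Fin k → Fin k → ℂ) (l : Fin k) (hl : 0 < n l) (p : ℕ)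
    (hp : p < ∑ i, remove n l i) (v : words (remove n l) →₀ ℂ) :
    moveOp q n p (snocMap n l hl v) = snocMap n l hl (moveOp q (remove n l) p v) := by
  induction v using Finsupp.induction_linear with
  | zero => simp
  | add v w hv hw => simp only [map_add, hv, hw]
  | single w c =>
    obtain ⟨w, hw⟩ := w
    rw [← length_of_mem_words hw] at hp
    obtain ⟨a, m, b, rfl, rfl⟩ := exists_split w p hp
    simp only [moveOp, snocMap, weightedMap_single, moveFront_split, moveWeight_split,
      List.append_assoc, List.cons_append, mul_one]

/-- In the absence of constants in every `B_{Q_j}`, the partial sum leaving the last letter in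
place is injective. -/
theorem ker_sum_moveOp_eq_bot (q : Fin k → Fin k → ℂ) (hn : 2 ≤ ∑ i, n i)
    (hconst : ∀ j, constantsIn q (remove n j) = ⊥) :
    LinearMap.ker (∑ p ∈ Finset.range (∑ i, n i - 1), moveOp q n p) = ⊥ := by
  -- In finite dimension surjectivity suffices, and it can be checked on one basis word, hence for
  -- one last letter, at a time.
  rw [LinearMap.ker_eq_bot, LinearMap.injective_iff_surjective, ← LinearMap.range_eq_top,
    eq_top_iff]
  have hspan : (⊤ : Submodule ℂ (words n →₀ ℂ)) =
      Submodule.span ℂ (Set.range fun w => Finsupp.single w 1) := by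
    simpa using (Finsupp.basisSingleOne (R := ℂ) (ι := words n)).span_eq.symm
  rw [hspan, Submodule.span_le]
  rintro _ ⟨⟨w, hw⟩, rfl⟩
  obtain ⟨v, l, rfl⟩ := exists_snoc (by rw [length_of_mem_words hw]; omega)
  have hl : 0 < n l := pos_of_mem_words hw (by simp)
  have hv := (snoc_mem_words hl).1 hw
  have hinj : LinearMap.ker (eulerOp q (remove n l)) = ⊥ := by
    have h := hconst l
    rw [constantsIn_eq_map q (by rw [sum_remove hl]; omega)] at h
    exact Submodule.map_injective_of_injective toFreeAlg_injective
      (h.trans (Submodule.map_bot _).symm)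
  obtain ⟨y, hy⟩ := LinearMap.injective_iff_surjective.1 (LinearMap.ker_eq_bot.1 hinj)
    (Finsupp.single ⟨v, hv⟩ 1)
  refine ⟨snocMap n l hl y, ?_⟩
  rw [LinearMap.sum_apply, ← sum_remove hl, Finset.sum_congr rfl fun p hp =>
    moveOp_snocMap q l hl p (Finset.mem_range.1 hp) y, ← map_sum, ← LinearMap.sum_apply]
  change snocMap n l hl (eulerOp q (remove n l) y) = _
  rw [hy, snocMap, weightedMap_single, mul_one]

theorem finrank_ker_eulerOp_add (q : Fin k → Fin k → ℂ) (hn : 2 ≤ ∑ i, n i)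
    (hconst : ∀ j, constantsIn q (remove n j) = ⊥) :
    Module.finrank ℂ (LinearMap.ker (eulerOp q n)) +
      Module.finrank ℂ (LinearMap.ker (1 - moveOp q n (∑ i, n i - 1))) =
      Module.finrank ℂ (LinearMap.ker (1 - tailOp q n)) := by
  have h := finrank_ker_sum_add (∑ i, n i - 1) (moveOp q n) (tailOp q n)
    (moveOp_zero q (by omega)) (moveOp_succ_mul q (by omega))
    (ker_sum_moveOp_eq_bot q hn hconst)
    (by rw [moveOp_last q (by omega)]; exact disjoint_ker_range_weightedMap _ _)
    (disjoint_ker_range_weightedMap _ _)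
  rwa [Nat.sub_add_cancel (by omega)] at h

/-! ### Fixed spaces and the orbit counts χ, χ_j -/

theorem mem_orbit {v w : List (Fin k)} : v ∈ orbit w ↔ v.IsRotated w := by
  rw [orbit, List.mem_toFinset, List.mem_cyclicPermutations_iff]

theorem orbit_eq_orbit {v w : List (Fin k)} : orbit v = orbit w ↔ v.IsRotated w := by
  constructor
  · intro h
    rw [← mem_orbit, ← h, mem_orbit]
  · intro h
    ext u
    rw [mem_orbit, mem_orbit]
    exact ⟨fun hu => hu.trans h, fun hu => hu.trans h.symm⟩

theorem mem_words_of_mem_orbit {v w : List (Fin k)} (hw : w ∈ words n) (h : v ∈ orbit w) :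
    v ∈ words n :=
  words_of_perm (mem_orbit.1 h).perm hw

theorem finite_words : (words n).Finite := Set.toFinite _

theorem finite_singularOrbits (f : List (Fin k) → ℂ) : (singularOrbits f n).Finite := by
  refine ((finite_words (n := n)).image orbit).subset ?_
  rintro _ ⟨w, hw, rfl, -⟩
  exact ⟨w, hw, rfl⟩

theorem prod_orbit_filter (f : List (Fin k) → ℂ) {w : List (Fin k)} (hw : w ∈ words n)
    {_ : DecidablePred fun z : words n => orbit z.1 = orbit w} :
    ∏ z : words n with orbit z.1 = orbit w, f z.1 = ∏ v ∈ orbit w, f v := by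
  refine Finset.prod_bij (fun z _ => z.1) ?_ (fun _ _ _ _ => Subtype.ext) ?_ (fun _ _ => rfl)
  · intro z hz
    exact mem_orbit.2 (orbit_eq_orbit.1 (Finset.mem_filter.1 hz).2)
  · intro v hv
    exact ⟨⟨v, mem_words_of_mem_orbit hw hv⟩, Finset.mem_filter.2 ⟨Finset.mem_univ _,
      orbit_eq_orbit.2 (mem_orbit.1 hv)⟩, rfl⟩

theorem finrank_ker_one_sub_moveOp (q : Fin k → Fin k → ℂ) (hn : 0 < ∑ i, n i) :
    Module.finrank ℂ (LinearMap.ker (1 - moveOp q n (∑ i, n i - 1))) = chi q n := by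
  rw [moveOp_last q hn, finrank_ker_one_sub_weightedMap _ _ (fun w => orbit w.1), chi]
  · congr 1
    ext O
    constructor
    · rintro ⟨⟨w, hw⟩, rfl, h⟩
      exact ⟨w, hw, rfl, (prod_orbit_filter (commFactor q) hw).symm.trans h⟩
    · rintro ⟨w, hw, rfl, h⟩
      exact ⟨⟨w, hw⟩, rfl, (prod_orbit_filter (commFactor q) hw).trans h⟩
  · intro v w
    rw [Equiv.Perm.sameCycle_inv, sameCycle_rotPerm]
    exact orbit_eq_orbit

theorem ncard_iUnion_image {ι A B : Type*} [Fintype ι] (g : ι → A → B)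
    (hg : ∀ i j a b, g i a = g j b → i = j ∧ a = b) (s : ι → Set A) (hs : ∀ i, (s i).Finite) :
    (⋃ i, g i '' s i).ncard = ∑ i, (s i).ncard := by
  rw [Set.ncard_iUnion_of_finite (fun i => (hs i).image _), finsum_eq_sum_of_fintype]
  · exact Finset.sum_congr rfl fun i _ =>
      Set.ncard_image_of_injective _ fun a b h => (hg i i a b h).2
  · intro i j hij
    rw [Function.onFun, Set.disjoint_left]
    rintro _ ⟨a, -, rfl⟩ ⟨b, -, h⟩
    exact hij (hg j i b a h).1.symm

theorem prod_tailWeight_filter (q : Fin k → Fin k → ℂ) (hpos : ∀ i, 0 < n i) {j : Fin k}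
    {v : List (Fin k)} (hv : v ∈ words (remove n j))
    {_ : DecidablePred fun z : words n => (z.1.head?, orbit z.1.tail) = (some j, orbit v)} :
    ∏ z : words n with (z.1.head?, orbit z.1.tail) = (some j, orbit v), tailWeight q z.1 =
      ∏ u ∈ orbit v, commFactorAt q j u := by
  symm
  refine Finset.prod_bij
    (fun u hu => ⟨j :: u, (cons_mem_words (hpos j)).2 (mem_words_of_mem_orbit hv hu)⟩)
    ?_ ?_ ?_ ?_
  · intro u hu
    rw [Finset.mem_filter]
    exact ⟨Finset.mem_univ _, Prod.ext rfl (orbit_eq_orbit.2 (mem_orbit.1 hu))⟩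
  · intro u _ u' _ h
    exact (List.cons.inj (Subtype.ext_iff.1 h)).2
  · rintro ⟨z, hz⟩ h
    have h' := (Finset.mem_filter.1 h).2
    rw [Prod.mk.injEq] at h'
    rcases z with _ | ⟨i, u⟩
    · simp at h'
    · obtain rfl : i = j := by simpa using h'.1
      exact ⟨u, mem_orbit.2 (orbit_eq_orbit.1 h'.2), rfl⟩
  · exact fun _ _ => rfl

/-- A cycle of the tail rotation is a first letter j together with a cyclic orbit in Q̂_j, so the
count splits as a sum over j. -/
theorem finrank_ker_one_sub_tailOp (q : Fin k → Fin k → ℂ) (hpos : ∀ i, 0 < n i)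
    (hn : 0 < ∑ i, n i) :
    Module.finrank ℂ (LinearMap.ker (1 - tailOp q n)) = ∑ j, chiAt q n j := by
  rw [tailOp, finrank_ker_one_sub_weightedMap _ _ (fun w => (w.1.head?, orbit w.1.tail))]
  · simp only [chiAt]
    rw [← ncard_iUnion_image (fun j O => (some j, O)) (by simp) _
      (fun j => finite_singularOrbits _)]
    congr 1
    ext y
    rw [Set.mem_iUnion]
    constructor
    · rintro ⟨⟨w, hw⟩, rfl, h⟩
      rcases w with _ | ⟨j, v⟩
      · have := length_of_mem_words hw
        simp at this; omega
      · have hv := (cons_mem_words (hpos j)).1 hw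
        exact ⟨j, orbit v, ⟨v, hv, rfl, (prod_tailWeight_filter q hpos hv).symm.trans h⟩, rfl⟩
    · rintro ⟨j, _, ⟨v, hv, rfl, h⟩, rfl⟩
      exact ⟨⟨j :: v, (cons_mem_words (hpos j)).2 hv⟩, rfl,
        (prod_tailWeight_filter q hpos hv).trans h⟩
  · intro v w
    rw [Equiv.Perm.sameCycle_inv, sameCycle_tailRotPerm, Prod.mk.injEq, orbit_eq_orbit]

/-- The dimension formula for the space of constants. -/
theorem finrank_constantsIn_add_chi (q : Fin k → Fin k → ℂ) (hpos : ∀ i, 0 < n i)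
    (hn : 2 ≤ ∑ i, n i) (hconst : ∀ j, constantsIn q (remove n j) = ⊥) :
    FiniteDimensional ℂ (constantsIn q n) ∧
      Module.finrank ℂ (constantsIn q n) + chi q n = ∑ j, chiAt q n j := by
  have h := finrank_ker_eulerOp_add q hn hconst
  rw [finrank_ker_one_sub_moveOp q (by omega), finrank_ker_one_sub_tailOp q hpos (by omega)] at h
  rw [constantsIn_eq_map q (by omega)]
  refine ⟨inferInstance, ?_⟩
  rwa [← (Submodule.equivMapOfInjective _ toFreeAlg_injective _).finrank_eq]

/-! ### Counting words and orbits without short orbits -/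

theorem prod_factorial_eq {j : Fin k} (hj : 0 < n j) :
    ∏ i, (n i).factorial = n j * ∏ i, (remove n j i).factorial := by
  rw [← Finset.mul_prod_erase _ _ (Finset.mem_univ j),
    ← Finset.mul_prod_erase _ (fun i => (remove n j i).factorial) (Finset.mem_univ j), ← mul_assoc]
  congr 1
  · simp [remove, Nat.mul_factorial_pred hj.ne']
  · refine Finset.prod_congr rfl fun i hi => ?_
    rw [remove, Function.update_of_ne (Finset.ne_of_mem_erase hi)]

/-- The number of words with given multiplicities is a multinomial coefficient. -/
theorem ncard_words_mul (n : Fin k → ℕ) :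
    (words n).ncard * ∏ i, (n i).factorial = (∑ i, n i).factorial := by
  induction hN : ∑ i, n i generalizing n with
  | zero =>
    have h0 : ∀ i, n i = 0 := by simpa using hN
    have : words n = {[]} := by
      ext w
      constructor
      · intro hw
        exact List.length_eq_zero_iff.1 ((length_of_mem_words hw).trans hN)
      · rintro rfl i
        simp [h0]
    simp [this, h0]
  | succ N ih =>
    -- Split by the first letter; the guard 0 < n j is needed because `remove` truncates at 0.
    have hU : words n = ⋃ j, List.cons j '' {v | 0 < n j ∧ v ∈ words (remove n j)} := by
      ext w
      simp only [Set.mem_iUnion]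
      constructor
      · intro hw
        rcases w with _ | ⟨j, v⟩
        · have := length_of_mem_words hw
          rw [hN] at this; simp at this
        · have hj := pos_of_mem_words hw List.mem_cons_self
          exact ⟨j, v, ⟨hj, (cons_mem_words hj).1 hw⟩, rfl⟩
      · rintro ⟨j, v, ⟨hj, hv⟩, rfl⟩
        exact (cons_mem_words hj).2 hv
    rw [hU, ncard_iUnion_image _ (fun i j a b h => by simpa using h) _
      (fun j => finite_words.subset fun v hv => hv.2), Finset.sum_mul, Nat.factorial_succ, ← hN,
      Finset.sum_mul]
    refine Finset.sum_congr rfl fun j _ => ?_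
    rcases Nat.eq_zero_or_pos (n j) with hj | hj
    · simp [hj]
    · have h1 := ih (remove n j) (by rw [sum_remove hj, hN]; rfl)
      have h2 : {v | 0 < n j ∧ v ∈ words (remove n j)} = words (remove n j) := by
        ext v; exact and_iff_right hj
      rw [h2, prod_factorial_eq hj, ← h1]
      ring

/-- All orbits qualify, and they partition the words into classes of size equal to the word length.
-/
theorem ncard_singularOrbits_mul (f : List (Fin k) → ℂ) (hs : NoShortOrbits n)
    (hf : ∀ w ∈ words n, ∏ v ∈ orbit w, f v = 1) :
    (singularOrbits f n).ncard * ∑ i, n i = (words n).ncard := by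
  classical
  have hfin := finite_words (n := n)
  have hS : singularOrbits f n = (hfin.toFinset.image orbit : Finset (Finset (List (Fin k)))) := by
    ext O
    simp only [Finset.coe_image, Set.Finite.coe_toFinset, Set.mem_image]
    constructor
    · rintro ⟨w, hw, rfl, -⟩
      exact ⟨w, hw, rfl⟩
    · rintro ⟨w, hw, rfl⟩
      exact ⟨w, hw, rfl, hf w hw⟩
  rw [hS, Set.ncard_coe_finset, Set.ncard_eq_toFinset_card _ hfin,
    Finset.card_eq_sum_card_image orbit hfin.toFinset, ← smul_eq_mul, ← Finset.sum_const]
  refine Finset.sum_congr rfl fun O hO => ?_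
  obtain ⟨w, hw, rfl⟩ := Finset.mem_image.1 hO
  rw [Set.Finite.mem_toFinset] at hw
  rw [← length_of_mem_words hw, ← hs w hw]
  congr 1
  ext v
  rw [Finset.mem_filter, Set.Finite.mem_toFinset, orbit_eq_orbit, mem_orbit]
  exact ⟨fun h => ⟨words_of_perm h.perm hw, h⟩, fun h => h.2⟩

/-- On an orbit that is not short, the product of a function of the last letter runs over the
letters of the word. -/
theorem prod_orbit_of_last (f : List (Fin k) → ℂ) (G : Fin k → ℂ) (w : List (Fin k))
    (hw : 0 < w.length) (hcard : (orbit w).card = w.length)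
    (hf : ∀ u l, (u ++ [l]).Perm w → f (u ++ [l]) = G l) :
    ∏ v ∈ orbit w, f v = (w.map G).prod := by
  have hlen := List.length_cyclicPermutations_of_ne_nil w (List.ne_nil_of_length_pos hw)
  have hnd : w.cyclicPermutations.Nodup := by
    rw [← Multiset.coe_nodup, ← Multiset.toFinset_card_eq_card_iff_nodup]
    exact hcard.trans hlen.symm
  rw [orbit, List.prod_toFinset _ hnd]
  -- Starting from `w.rotate 1` makes the i-th cyclic permutation end in `w[i]`, so the products
  -- match entry by entry.
  have hperm : (w.rotate 1).cyclicPermutations.Perm w.cyclicPermutations := by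
    rw [List.cyclicPermutations_rotate]
    exact List.rotate_perm _ _
  rw [← (hperm.map f).prod_eq]
  congr 1
  apply List.ext_getElem
  · rw [List.length_map, List.length_map, hperm.length_eq, hlen]
  · intro i h1 h2
    rw [List.length_map] at h2
    have e : (w.rotate 1).rotate i = (w.drop (i + 1) ++ w.take i) ++ [w[i]] := by
      rw [List.rotate_rotate, add_comm, ← List.rotate_rotate,
        List.rotate_eq_drop_append_take h2.le, List.drop_eq_getElem_cons h2, List.cons_append,
        List.rotate_cons_succ, List.rotate_zero]
    rw [List.getElem_map, List.getElem_map, List.getElem_cyclicPermutations, e]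
    apply hf
    rw [← e]
    exact (List.rotate_perm _ _).trans (List.rotate_perm _ _)

theorem prod_map_of_mem_words {w : List (Fin k)} (hw : w ∈ words n) (g : Fin k → ℂ) :
    (w.map g).prod = ∏ i, g i ^ n i := by
  rw [Finset.prod_list_map_count]
  simp only [hw _]
  refine Finset.prod_subset (Finset.subset_univ _) fun i _ hi => ?_
  rw [← hw i, List.count_eq_zero.2 (by simpa using hi), pow_zero]

theorem pairProduct_eq (q : Fin k → Fin k → ℂ) (n : Fin k → ℕ) :
    pairProduct q n = ∏ l, (∏ i, q l i ^ remove n l i) ^ n l := by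
  refine Finset.prod_congr rfl fun l _ => ?_
  rw [← Finset.prod_pow]
  refine Finset.prod_congr rfl fun i _ => ?_
  rw [← pow_mul]
  by_cases h : l = i
  · subst h; simp [remove, mul_comm]
  · rw [if_neg h, remove, Function.update_of_ne (Ne.symm h), mul_comm]

/-- Each position of w is last exactly once, and then contributes its q-factors against all the
other positions. -/
theorem prod_orbit_commFactor (q : Fin k → Fin k → ℂ) (hs : NoShortOrbits n)
    (hn : 0 < ∑ i, n i) {w : List (Fin k)} (hw : w ∈ words n) :
    ∏ v ∈ orbit w, commFactor q v = pairProduct q n := by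
  rw [pairProduct_eq, ← prod_map_of_mem_words hw]
  refine prod_orbit_of_last _ _ w (by rwa [length_of_mem_words hw]) (hs w hw) fun u l h => ?_
  have hu := words_of_perm h hw
  rw [commFactor_snoc,
    prod_map_of_mem_words ((snoc_mem_words (pos_of_mem_words hu (by simp))).1 hu)]

/-- The words j u with u in the orbit of w have each letter of w last once. The extra factors q_{jl}
supply the pairs whose first member is the fixed j. -/
theorem prod_orbit_commFactorAt (q : Fin k → Fin k → ℂ) {j : Fin k} (hj : 0 < n j)
    (hs : NoShortOrbits (remove n j)) (hn : 2 ≤ ∑ i, n i) {w : List (Fin k)}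
    (hw : w ∈ words (remove n j)) :
    ∏ v ∈ orbit w, commFactorAt q j v = pairProduct q n := by
  rw [pairProduct_eq, ← prod_map_of_mem_words ((cons_mem_words hj).2 hw), List.map_cons,
    List.prod_cons, ← prod_map_of_mem_words hw, ← List.prod_map_mul]
  refine prod_orbit_of_last _ _ w
    (by rw [length_of_mem_words hw, sum_remove hj]; omega) (hs w hw) fun u l h => ?_
  have hu : (j :: u) ++ [l] ∈ words n := (cons_mem_words hj).2 (words_of_perm h hw)
  rw [commFactorAt_snoc, ← prod_map_of_mem_words
    ((snoc_mem_words (pos_of_mem_words hu (by simp))).1 hu), List.map_cons, List.prod_cons]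

theorem chi_mul (q : Fin k → Fin k → ℂ) (hn : 2 ≤ ∑ i, n i) (hs : NoShortOrbits n)
    (hp : pairProduct q n = 1) :
    chi q n * ∏ i, (n i).factorial = (∑ i, n i - 1).factorial := by
  have h1 := ncard_singularOrbits_mul (commFactor q) hs
    (fun w hw => (prod_orbit_commFactor q hs (by omega) hw).trans hp)
  have h2 := ncard_words_mul n
  rw [← h1, ← Nat.mul_factorial_pred (n := ∑ i, n i) (by omega)] at h2
  refine Nat.eq_of_mul_eq_mul_left (show 0 < ∑ i, n i by omega) ?_
  rw [← h2, chi]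
  ring

theorem chiAt_mul (q : Fin k → Fin k → ℂ) {j : Fin k} (hj : 0 < n j) (hn : 2 ≤ ∑ i, n i)
    (hs : NoShortOrbits (remove n j)) (hp : pairProduct q n = 1) :
    chiAt q n j * ∏ i, (n i).factorial = n j * (∑ i, n i - 2).factorial := by
  have h1 := ncard_singularOrbits_mul (commFactorAt q j) hs
    (fun w hw => (prod_orbit_commFactorAt q hj hs hn hw).trans hp)
  have h2 := ncard_words_mul (remove n j)
  rw [← h1, sum_remove hj, ← Nat.mul_factorial_pred (n := ∑ i, n i - 1) (by omega),
    Nat.sub_sub] at h2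
  refine Nat.eq_of_mul_eq_mul_left (show 0 < ∑ i, n i - 1 by omega) ?_
  rw [mul_left_comm (∑ i, n i - 1) (n j), ← h2, chiAt, prod_factorial_eq hj]
  ring

end QDiff

end

theorem mainTheorem3 (k : ℕ) (n : Fin k → ℕ) (hpos : ∀ i, 0 < n i) (hn : 2 ≤ ∑ i, n i)
    (q : Fin k → Fin k → ℂ) (hq : ∀ i j, q i j ≠ 0)
    (hconst : ∀ j, QDiff.constantsIn q (QDiff.remove n j) = ⊥) :
    FiniteDimensional ℂ (QDiff.constantsIn q n) ∧
    (Module.finrank ℂ (QDiff.constantsIn q n) : ℤ) =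
      (∑ j, (QDiff.chiAt q n j : ℤ)) - (QDiff.chi q n : ℤ) ∧
    (QDiff.NoShortOrbits n → (∀ j, QDiff.NoShortOrbits (QDiff.remove n j)) →
      QDiff.pairProduct q n = 1 →
      (QDiff.chi q n : ℚ) =
        (Nat.factorial ((∑ i, n i) - 1) : ℚ) / ∏ i, (Nat.factorial (n i) : ℚ) ∧
      (∀ j, (QDiff.chiAt q n j : ℚ) =
        (n j : ℚ) * (Nat.factorial ((∑ i, n i) - 2) : ℚ) / ∏ i, (Nat.factorial (n i) : ℚ)) ∧
      (Module.finrank ℂ (QDiff.constantsIn q n) : ℚ) =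
        (Nat.factorial ((∑ i, n i) - 2) : ℚ) / ∏ i, (Nat.factorial (n i) : ℚ)) := by
  obtain ⟨hfd, hdim⟩ := QDiff.finrank_constantsIn_add_chi q hpos hn hconst
  refine ⟨hfd, ?_, fun hs hs' hp => ?_⟩
  · rw [eq_sub_iff_add_eq]
    exact_mod_cast hdim
  · have hP : (∏ i, (Nat.factorial (n i) : ℚ)) ≠ 0 :=
      Finset.prod_ne_zero_iff.2 fun i _ => by exact_mod_cast Nat.factorial_ne_zero _
    have hchi : (QDiff.chi q n : ℚ) * ∏ i, (Nat.factorial (n i) : ℚ) =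
        (Nat.factorial ((∑ i, n i) - 1) : ℚ) := by
      exact_mod_cast QDiff.chi_mul q hn hs hp
    have hchiAt : ∀ j, (QDiff.chiAt q n j : ℚ) * ∏ i, (Nat.factorial (n i) : ℚ) =
        (n j : ℚ) * (Nat.factorial ((∑ i, n i) - 2) : ℚ) := fun j => by
      exact_mod_cast QDiff.chiAt_mul q (hpos j) hn (hs' j) hp
    refine ⟨(eq_div_iff hP).2 hchi, fun j => (eq_div_iff hP).2 (hchiAt j), (eq_div_iff hP).2 ?_⟩
    have hdimQ : (Module.finrank ℂ (QDiff.constantsIn q n) : ℚ) + (QDiff.chi q n : ℚ) =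
        ∑ j, (QDiff.chiAt q n j : ℚ) := by exact_mod_cast hdim
    -- With N = ∑ n_j, the dimension is N(N-2)! - (N-1)(N-2)! = (N-2)!, up to the common
    -- denominator.
    have hfac : (Nat.factorial ((∑ i, n i) - 1) : ℚ) =
        ((∑ j, (n j : ℚ)) - 1) * (Nat.factorial ((∑ i, n i) - 2) : ℚ) := by
      obtain ⟨N, hN⟩ := Nat.exists_eq_add_of_le hn
      have hN' : (∑ j, (n j : ℚ)) = 2 + N := by exact_mod_cast hN
      rw [hN', hN, show 2 + N - 1 = N + 1 by omega, show 2 + N - 2 = N by omega,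
        Nat.factorial_succ]
      push_cast
      ring
    rw [eq_sub_of_add_eq hdimQ, sub_mul, hchi, Finset.sum_mul,
      Finset.sum_congr rfl fun j _ => hchiAt j, ← Finset.sum_mul, hfac]
    ring
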